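/- Let $D\subset\mathbb{R}^3$ be an open set containing the origin, and let $u\in C^1(D\setminus\{0\},\mathbb{R}^3)$ satisfy $\operatorname{div}u=0$ on $D\setminus\{0\}$. For $\rho>0$ let $B_\rho$ be the open ball of radius $\rho$ centred at the origin, let $\hat n(x)=x/|x|$ for $x\neq 0$, and let $\sigma$ denote surface measure on $\partial B_\rho$. For $\eta\in D\setminus\{0\}$ let $\gamma_\eta$ be the streamline starting at $\eta$, that is, the maximal forward solution in $D\setminus\{0\}$ of $\gamma_\eta'(s)=u(\gamma_\eta(s))$, $\gamma_\eta(0)=\eta$ (it may be defined for finite time only). For $0<r<\alpha$ let $$A_r^\alpha=\{\eta\in\partial B_\alpha\cap D:\ \text{there is } s>0 \text{ in the domain of } \gamma_\eta \text{ with } \gamma_\eta(s)\in B_r \text{ and } \gamma_\eta(s')\in B_\alpha \text{ for } 0<s'<s\}.$$ Suppose that for some $\alpha>0$ and some ($\sigma$-measurable) set $A\subset\partial B_\alpha$ the integral $\int_A u\cdot\hat n\,d\sigma$ exists and is nonzero, and that $A\subset A_r^\alpha$ for every $0<r<\alpha$. Then $u\notin L^2(D)$. (In particular, no extension of $u$ to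 $\mathbb{R}^3$ belongs to $L^2(\mathbb{R}^3)$; for $D=\mathbb{R}^3$ this says $u\notin L^2(\mathbb{R}^3)$.) -/

import Mathlib

open MeasureTheory Set Metric

noncomputable section

/-- Euclidean space `ℝ³`. -/
abbrev E3 : Type := EuclideanSpace ℝ (Fin 3)

/-- The divergence `∑ i, ∂ u_i / ∂ x_i` of a vector field (used only where `u` is `C¹`). -/
def divergence (u : E3 → E3) (x : E3) : ℝ :=
  ∑ i : Fin 3, (fderiv ℝ u x (EuclideanSpace.single i 1)) i

/-- The outward radial unit vector `x / |x|` (used only at `x ≠ 0`). -/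
def nHat (x : E3) : E3 := ‖x‖⁻¹ • x

/-- The surface measure on the sphere `∂B_α`, for `α > 0`, as a measure on `ℝ³` carried by that
sphere: the image of the surface measure of the unit sphere under `x ↦ α x`, times `α²`. -/
def sphereMeasure (α : ℝ) : Measure E3 :=
  ENNReal.ofReal (α ^ 2) •
    Measure.map (fun x : sphere (0 : E3) 1 => α • (x : E3)) (volume : Measure E3).toSphere

/-- `γ` restricted to `[0, s]` is the streamline of `u` that starts at `η`: it solves
`γ' = u ∘ γ` with `γ 0 = η` and lies in `D \ {0}`, where `u` is defined. For `u` of class `C¹` on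
the open set `D \ {0}` such a curve is unique on `[0, s]`, and it exists if and only if the maximal
streamline from `η` is defined beyond time `s`. Streamlines need not exist for all times: they may
run into the origin in finite time. -/
def IsStreamline (D : Set E3) (u : E3 → E3) (η : E3) (s : ℝ) (γ : ℝ → E3) : Prop :=
  γ 0 = η ∧ (∀ t ∈ Icc 0 s, γ t ∈ D \ {0}) ∧
    ∀ t ∈ Icc 0 s, HasDerivWithinAt γ (u (γ t)) (Icc 0 s) t

/-- The set `A_r^α` of the points `η ∈ ∂B_α` whose streamline is in `B_r` at some time `s > 0`, and
in `B_α` at all times strictly between `0` and `s`. -/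
def streamSet (D : Set E3) (u : E3 → E3) (r α : ℝ) : Set E3 :=
  {η | η ∈ sphere (0 : E3) α ∧ ∃ s > 0, ∃ γ : ℝ → E3, IsStreamline D u η s γ ∧
    γ s ∈ ball (0 : E3) r ∧ ∀ t ∈ Ioo 0 s, γ t ∈ ball (0 : E3) α}

end

/-! Suppose `u` is in L². By Cauchy–Schwarz the integral of |u| over D ∩ B_ε is O(ε^(3/2))
(`lintegral_ball_le_of_memLp`). On the other hand, every streamline from A reaches B_{ε/2}, so it
has length at least ε/2 inside B_ε (`le_lintegral_speed`). For an incompressible flow, the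
streamlines through dσ sweep out volume |u·n| dσ dt, so the integral of |u| over the tube is flux
times length. Hence (ε/2) ∫_A |u·n| dσ ≤ ∫_{D ∩ B_ε} |u| (`flux_mul_le_lintegral`). The flux is
therefore O(√ε), that is, zero.

The volume element is the substance. A starting point on ∂B_α and a time t are coded by the single
point x on the same ray with |x| = α + t. Thus `tubeMap` is defined on an open subset of ℝ³ and the
usual change of variables applies. Its derivative is the fundamental solution M of the variational
equation (`solution_expansion`) composed with `coneDeriv`. The former has determinant 1 by
Liouville's formula, the latter (α/|x|)² u·n, and the polar weight |x|² turns this into α² u·n.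
Injectivity (`injOn_tubeMap`) holds because the streamlines do not return to the sphere. -/

noncomputable section

open Filter Topology

/-! ### Flows of `C¹` fields: existence, uniqueness, first order expansion. -/

section FlowTheory

variable {F : Type*} [NormedAddCommGroup F] [NormedSpace ℝ F]

/-- Grönwall's inequality on the unit interval with an explicit bound. -/
lemma norm_le_of_deriv_bound_unitInterval {f f' : ℝ → F} {K ε δ : ℝ} (hK : 0 < K) (hε : 0 ≤ ε)
    (hδ : 0 ≤ δ) (hf : ∀ t ∈ Icc (0 : ℝ) 1, HasDerivWithinAt f (f' t) (Icc 0 1) t)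
    (h0 : ‖f 0‖ ≤ δ) (bound : ∀ t ∈ Icc (0 : ℝ) 1, ‖f' t‖ ≤ K * ‖f t‖ + ε) :
    ∀ t ∈ Icc (0 : ℝ) 1, ‖f t‖ ≤ (δ + ε / K) * Real.exp K := by
  intro t ht
  have h1 := norm_le_gronwallBound_of_norm_deriv_right_le (f := f) (f' := f') (δ := δ) (K := K)
    (ε := ε) (a := 0) (b := 1) (fun t ht => (hf t ht).continuousWithinAt)
    (fun t ht => (hf t (Ico_subset_Icc_self ht)).mono_of_mem_nhdsWithin
      (Icc_mem_nhdsGE_of_mem ht)) h0 (fun t ht => bound t (Ico_subset_Icc_self ht)) t ht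
  refine h1.trans ?_
  have h2 := gronwallBound_mono hδ hε hK.le (show t - 0 ≤ 1 by linarith [ht.2])
  refine h2.trans ?_
  simp only [gronwallBound_of_K_ne_0 hK.ne', mul_one, add_mul]
  have : 0 ≤ ε / K := by positivity
  nlinarith

/-- Solutions on the unit interval of a bounded globally Lipschitz time-dependent field. -/
lemma exists_solution_of_bounded_lipschitz [CompleteSpace F] {f : ℝ → F → F} {K L : NNReal}
    (hlip : ∀ t ∈ Icc (0 : ℝ) 1, LipschitzWith K (f t))
    (hcont : ∀ x, ContinuousOn (fun t => f t x) (Icc 0 1))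
    (hL : ∀ t ∈ Icc (0 : ℝ) 1, ∀ x, ‖f t x‖ ≤ L) (x₀ : F) :
    ∃ c : ℝ → F, c 0 = x₀ ∧
      ∀ t ∈ Icc (0 : ℝ) 1, HasDerivWithinAt c (f t (c t)) (Icc 0 1) t := by
  -- A curve of speed at most L stays within distance L of `x₀` during unit time, so the ball of
  -- radius L suffices.
  have hp : IsPicardLindelof f (tmin := 0) (tmax := 1) ⟨0, by simp⟩ x₀ L 0 L K :=
    ⟨fun t ht => (hlip t ht).lipschitzOnWith, fun x _ => hcont x, fun t ht x _ => hL t ht x,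
      by simp⟩
  exact hp.exists_eq_forall_mem_Icc_hasDerivWithinAt₀

/-- A linear ordinary differential equation has a solution on the unit interval. -/
lemma exists_solution_linear [FiniteDimensional ℝ F] {A : ℝ → F →L[ℝ] F}
    (hA : ContinuousOn A (Icc 0 1)) (x₀ : F) :
    ∃ c : ℝ → F, c 0 = x₀ ∧
      ∀ t ∈ Icc (0 : ℝ) 1, HasDerivWithinAt c (A t (c t)) (Icc 0 1) t := by
  have : CompleteSpace F := FiniteDimensional.complete ℝ F
  obtain ⟨K₀, hK₀⟩ := isCompact_Icc.exists_bound_of_continuousOn hA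
  set K : ℝ := max K₀ 1 with hKdef
  have hK0 : 0 < K := lt_of_lt_of_le one_pos (le_max_right _ _)
  have hK : ∀ t ∈ Icc (0 : ℝ) 1, ‖A t‖ ≤ K := fun t ht => (hK₀ t ht).trans (le_max_left _ _)
  -- A linear field is unbounded, so it is cut off. R exceeds the Grönwall bound, which survives the
  -- cut-off since ‖ρ y‖ ≤ ‖y‖; the solution never meets the altered region.
  set R : ℝ := ‖x₀‖ * Real.exp K + 1 with hR
  have hR0 : 0 < R := by positivity
  let χ : ContDiffBump (0 : F) := ⟨R, R + 1, hR0, by linarith⟩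
  set ρ : F → F := fun y => χ y • y with hρ
  have hρc : ContDiff ℝ 1 ρ := χ.contDiff.smul contDiff_id
  have hρs : HasCompactSupport ρ := χ.hasCompactSupport.smul_right
  obtain ⟨C, hC⟩ := hρc.lipschitzWith_of_hasCompactSupport hρs one_ne_zero
  have hρle : ∀ y, ‖ρ y‖ ≤ ‖y‖ := fun y => by
    rw [hρ]; simp only [norm_smul, Real.norm_eq_abs, abs_of_nonneg χ.nonneg]
    exact mul_le_of_le_one_left (norm_nonneg _) χ.le_one
  obtain ⟨B₀, hB₀⟩ := hρs.exists_bound_of_continuous hρc.continuous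
  have hB0 : 0 ≤ B₀ := (norm_nonneg _).trans (hB₀ 0)
  obtain ⟨c, hc0, hc⟩ := exists_solution_of_bounded_lipschitz (f := fun t y => A t (ρ y))
    (K := K.toNNReal * C) (L := (K * B₀).toNNReal)
    (fun t ht => by
      refine LipschitzWith.of_dist_le_mul fun x y => ?_
      rw [dist_eq_norm, ← map_sub]
      refine ((A t).le_opNorm _).trans ?_
      have := hC.dist_le_mul x y
      rw [dist_eq_norm] at this
      rw [NNReal.coe_mul, Real.coe_toNNReal _ hK0.le, mul_assoc]
      exact mul_le_mul (hK t ht) this (norm_nonneg _) hK0.le)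
    (fun x => hA.clm_apply continuousOn_const)
    (fun t ht x => by
      rw [Real.coe_toNNReal _ (by positivity)]
      exact ((A t).le_opNorm _).trans
        (mul_le_mul (hK t ht) (hB₀ x) (norm_nonneg _) hK0.le)) x₀
  refine ⟨c, hc0, fun t ht => ?_⟩
  have hb := norm_le_of_deriv_bound_unitInterval hK0 le_rfl (norm_nonneg x₀) hc
    (by rw [hc0]) (fun t ht => by
      rw [add_zero]
      exact ((A t).le_opNorm _).trans (mul_le_mul (hK t ht) (hρle _) (norm_nonneg _) hK0.le)) t ht
  have h1 : ρ (c t) = c t := by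
    have : χ (c t) = 1 := χ.one_of_mem_closedBall (by
      rw [mem_closedBall_zero_iff]
      change ‖c t‖ ≤ R
      rw [zero_div, add_zero] at hb
      linarith)
    simp [hρ, this]
  have := hc t ht
  rwa [h1] at this

/-- Two solutions of the same linear equation with the same initial value agree. -/
lemma linear_solution_unique {A : ℝ → F →L[ℝ] F} (hA : ContinuousOn A (Icc 0 1)) {c d : ℝ → F}
    (hc : ∀ t ∈ Icc (0 : ℝ) 1, HasDerivWithinAt c (A t (c t)) (Icc 0 1) t)
    (hd : ∀ t ∈ Icc (0 : ℝ) 1, HasDerivWithinAt d (A t (d t)) (Icc 0 1) t) (h0 : c 0 = d 0) :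
    ∀ t ∈ Icc (0 : ℝ) 1, c t = d t := by
  obtain ⟨K₀, hK₀⟩ := isCompact_Icc.exists_bound_of_continuousOn hA
  have hK0 : 0 < max K₀ 1 := lt_of_lt_of_le one_pos (le_max_right _ _)
  intro t ht
  have := norm_le_of_deriv_bound_unitInterval (f := fun t => c t - d t) hK0 le_rfl le_rfl
    (fun t ht => (hc t ht).sub (hd t ht)) (by simp [h0]) (fun t ht => by
      rw [add_zero, ← map_sub]
      exact ((A t).le_opNorm _).trans
        (mul_le_mul_of_nonneg_right ((hK₀ t ht).trans (le_max_left _ _)) (norm_nonneg _))) t ht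
  simpa [sub_eq_zero] using this

/-- A `C¹` field on an open set agrees near a compact subset with a compactly supported `C¹`
field on the whole space. -/
lemma exists_compactSupport_extension [FiniteDimensional ℝ F] {Ω K : Set F} (hΩ : IsOpen Ω)
    (hK : IsCompact K) (hKΩ : K ⊆ Ω) {u : F → F} (hu : ContDiffOn ℝ 1 u Ω) :
    ∃ v : F → F, ContDiff ℝ 1 v ∧ HasCompactSupport v ∧
      ∃ δ > 0, thickening δ K ⊆ Ω ∧ EqOn v u (thickening δ K) := by
  have : ProperSpace F := FiniteDimensional.proper ℝ F
  obtain ⟨δ, hδ, hδΩ⟩ := hK.exists_cthickening_subset_open hΩ hKΩ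
  obtain ⟨f, hf1, hf0, -⟩ := exists_contMDiffMap_one_nhds_of_subset_interior
    (n := 1) (modelWithCornersSelf ℝ F) (s := cthickening (δ / 2) K) (t := cthickening δ K)
    isClosed_cthickening
    ((cthickening_subset_thickening' hδ (by linarith) K).trans
      (interior_maximal (thickening_subset_cthickening δ K) isOpen_thickening))
  have hfc : ContDiff ℝ 1 f := contMDiff_iff_contDiff.1 f.contMDiff
  refine ⟨fun x => f x • u x, ?_, ?_, δ / 2, by linarith,
    (thickening_subset_cthickening _ _).trans ((cthickening_mono (by linarith) K).trans hδΩ), ?_⟩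
  · rw [contDiff_iff_contDiffAt]
    intro x
    by_cases hx : x ∈ Ω
    · exact hfc.contDiffAt.smul (hu.contDiffAt (hΩ.mem_nhds hx))
    · have hx' : (cthickening δ K)ᶜ ∈ 𝓝 x :=
        isClosed_cthickening.isOpen_compl.mem_nhds fun h => hx (hδΩ h)
      refine (contDiffAt_const (c := (0 : F))).congr_of_eventuallyEq ?_
      filter_upwards [hx'] with y hy
      rw [hf0 y hy, zero_smul]
  · refine HasCompactSupport.intro (hK.cthickening (r := δ)) fun x hx => ?_
    rw [hf0 x hx, zero_smul]
  · intro x hx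
    have := hf1.self_of_nhdsSet x (thickening_subset_cthickening _ _ hx)
    simp [this]

/-- A compactly supported `C¹` map is differentiable uniformly in the base point. -/
lemma uniform_differentiability {v : F → F} (hv : ContDiff ℝ 1 v) (hs : HasCompactSupport v)
    {ε : ℝ} (hε : 0 < ε) :
    ∃ δ > 0, ∀ y w, ‖w‖ ≤ δ → ‖v (y + w) - v y - fderiv ℝ v y w‖ ≤ ε * ‖w‖ := by
  have huc : UniformContinuous (fderiv ℝ v) :=
    (hv.continuous_fderiv one_ne_zero).uniformContinuous_of_tendsto_cocompact
      (hs.fderiv ℝ).is_zero_at_infty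
  obtain ⟨δ, hδ, h⟩ := Metric.uniformContinuous_iff.1 huc ε hε
  refine ⟨δ / 2, by linarith, fun y w hw => ?_⟩
  have h2 := (convex_closedBall y (δ / 2)).norm_image_sub_le_of_norm_fderiv_le' (𝕜 := ℝ)
    (f := v) (φ := fderiv ℝ v y) (C := ε) (x := y) (y := y + w)
    (fun x _ => (hv.differentiable one_ne_zero) x)
    (fun x hx => by
      rw [← dist_eq_norm]
      exact (h (lt_of_le_of_lt (mem_closedBall.1 hx) (by linarith))).le)
    (mem_closedBall_self (by linarith)) (by simpa using hw)
  simpa using h2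

/-- Solutions depend in a Lipschitz way on the initial point and on the speed. -/
lemma solution_dist_le {v : F → F} {K : NNReal} (hK : LipschitzWith K v) {L : ℝ}
    (hL : ∀ x, ‖v x‖ ≤ L) {c₀ : ℝ → F} {T₀ : ℝ}
    (hc₀ : ∀ t ∈ Icc (0 : ℝ) 1, HasDerivWithinAt c₀ (T₀ • v (c₀ t)) (Icc 0 1) t) :
    ∃ C ≥ 0, ∀ (T : ℝ) (c : ℝ → F),
      (∀ t ∈ Icc (0 : ℝ) 1, HasDerivWithinAt c (T • v (c t)) (Icc 0 1) t) →
      ∀ t ∈ Icc (0 : ℝ) 1, ‖c t - c₀ t‖ ≤ C * (‖c 0 - c₀ 0‖ + |T - T₀|) := by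
  have hL0 : 0 ≤ L := (norm_nonneg _).trans (hL 0)
  set K₁ : ℝ := |T₀| * K + 1 with hK₁
  have hK1 : 1 ≤ K₁ := by have : 0 ≤ |T₀| * (K : ℝ) := by positivity
                          linarith
  refine ⟨(1 + L) * Real.exp K₁, by positivity, fun T c hc t ht => ?_⟩
  have := norm_le_of_deriv_bound_unitInterval (f := fun t => c t - c₀ t) (K := K₁)
    (ε := |T - T₀| * L) (by linarith) (by positivity) (norm_nonneg (c 0 - c₀ 0))
    (fun t ht => (hc t ht).sub (hc₀ t ht)) le_rfl (fun t ht => by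
      have e : T • v (c t) - T₀ • v (c₀ t) = T₀ • (v (c t) - v (c₀ t)) + (T - T₀) • v (c t) := by
        module
      rw [e]
      refine (norm_add_le _ _).trans ?_
      rw [norm_smul, norm_smul, Real.norm_eq_abs, Real.norm_eq_abs]
      have h1 := hK.dist_le_mul (c t) (c₀ t)
      rw [dist_eq_norm, dist_eq_norm] at h1
      have h2 := mul_le_mul_of_nonneg_left h1 (abs_nonneg T₀)
      have h3 := mul_le_mul_of_nonneg_left (hL (c t)) (abs_nonneg (T - T₀))
      have h4 := norm_nonneg (c t - c₀ t)
      rw [hK₁]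
      nlinarith) t ht
  refine this.trans ?_
  have h1 : |T - T₀| * L / K₁ ≤ |T - T₀| * L := div_le_self (by positivity) hK1
  have h2 : ‖c 0 - c₀ 0‖ + |T - T₀| * L / K₁ ≤ (1 + L) * (‖c 0 - c₀ 0‖ + |T - T₀|) := by
    have := mul_nonneg hL0 (norm_nonneg (c 0 - c₀ 0))
    have := abs_nonneg (T - T₀)
    nlinarith
  have := mul_le_mul_of_nonneg_right h2 (Real.exp_pos K₁).le
  linarith

/-- The solution of the variational equation along an integral curve transports the field. -/
lemma variational_transport {v : F → F} {c₀ : ℝ → F} {T₀ : ℝ} {A M : ℝ → F →L[ℝ] F}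
    (hA : ∀ t ∈ Icc (0 : ℝ) 1, HasFDerivAt v (A t) (c₀ t)) (hAc : ContinuousOn A (Icc 0 1))
    (hc₀ : ∀ t ∈ Icc (0 : ℝ) 1, HasDerivWithinAt c₀ (T₀ • v (c₀ t)) (Icc 0 1) t)
    (hM0 : M 0 = 1)
    (hM : ∀ t ∈ Icc (0 : ℝ) 1, HasDerivWithinAt M ((T₀ • A t) ∘L M t) (Icc 0 1) t) :
    ∀ t ∈ Icc (0 : ℝ) 1, M t (v (c₀ 0)) = v (c₀ t) := by
  -- By the chain rule v ∘ c₀ also solves the variational equation.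
  refine linear_solution_unique (A := fun t => T₀ • A t) (hAc.const_smul T₀) (fun t ht => ?_)
    (fun t ht => ?_) (by simp [hM0])
  · simpa using (hM t ht).clm_apply (hasDerivWithinAt_const t _ (v (c₀ 0)))
  · have := (hA t ht).comp_hasDerivWithinAt t (hc₀ t ht)
    rw [map_smul] at this
    exact this

/-- First order expansion of the end point of a solution in its initial point and its speed. -/
lemma solution_expansion {v : F → F} (hv : ContDiff ℝ 1 v) (hs : HasCompactSupport v)
    {c₀ : ℝ → F} {T₀ : ℝ} {M : ℝ → F →L[ℝ] F}
    (hc₀ : ∀ t ∈ Icc (0 : ℝ) 1, HasDerivWithinAt c₀ (T₀ • v (c₀ t)) (Icc 0 1) t)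
    (hM0 : M 0 = 1)
    (hM : ∀ t ∈ Icc (0 : ℝ) 1,
      HasDerivWithinAt M ((T₀ • fderiv ℝ v (c₀ t)) ∘L M t) (Icc 0 1) t)
    {ε : ℝ} (hε : 0 < ε) :
    ∃ δ > 0, ∀ (T : ℝ) (c : ℝ → F),
      (∀ t ∈ Icc (0 : ℝ) 1, HasDerivWithinAt c (T • v (c t)) (Icc 0 1) t) →
      ‖c 0 - c₀ 0‖ + |T - T₀| ≤ δ →
      ‖c 1 - c₀ 1 - M 1 (c 0 - c₀ 0 + (T - T₀) • v (c₀ 0))‖ ≤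
        ε * (‖c 0 - c₀ 0‖ + |T - T₀|) := by
  have hcc : ContinuousOn c₀ (Icc 0 1) := fun t ht => (hc₀ t ht).continuousWithinAt
  have hMv := variational_transport (A := fun t => fderiv ℝ v (c₀ t))
    (fun t _ => (hv.differentiable one_ne_zero _).hasFDerivAt)
    ((hv.continuous_fderiv one_ne_zero).comp_continuousOn hcc) hc₀ hM0 hM
  obtain ⟨K, hK⟩ := hv.lipschitzWith_of_hasCompactSupport hs one_ne_zero
  obtain ⟨L, hL⟩ := hs.exists_bound_of_continuous hv.continuous
  obtain ⟨C, hC0, hC⟩ := solution_dist_le hK hL hc₀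
  obtain ⟨B, hB⟩ := isCompact_Icc.exists_bound_of_continuousOn
    (f := M) (s := Icc (0 : ℝ) 1) fun t ht => (hM t ht).continuousWithinAt
  have hB0 : 0 ≤ B := (norm_nonneg _).trans (hB 0 (by simp))
  have hL0 : 0 ≤ L := (norm_nonneg _).trans (hL 0)
  have hKn : (0 : ℝ) ≤ K := K.2
  set B' : ℝ := B * (1 + L) with hB'
  have hB'0 : 0 ≤ B' := by positivity
  set K₁ : ℝ := |T₀| * K + 1 with hK₁
  have hK1 : 1 ≤ K₁ := by have : 0 ≤ |T₀| * (K : ℝ) := by positivity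
                          linarith
  set X : ℝ := Real.exp K₁ with hX
  have hX0 : 0 < X := Real.exp_pos _
  set ε' : ℝ := ε / (2 * X * (|T₀| * B' + 1)) with hε'
  have hε'0 : 0 < ε' := by positivity
  obtain ⟨δ', hδ', hu⟩ := uniform_differentiability hv hs hε'0
  -- The first bound keeps ‖w‖ ≤ δ'. The second makes the term quadratic in N cost at most ε/2 · N;
  -- the choice of ε' does the same for the linearization error.
  refine ⟨min (δ' / (B' + 1)) (ε / (2 * X * (K * C + 1))), by positivity, fun T c hc hN => ?_⟩
  set N : ℝ := ‖c 0 - c₀ 0‖ + |T - T₀| with hNdef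
  have hN0 : 0 ≤ N := by positivity
  have hN1 : B' * N ≤ δ' := by
    have := (le_div_iff₀ (by positivity)).1 (hN.trans (min_le_left _ _))
    nlinarith
  have hN2 : X * (K * C * N) ≤ ε / 2 := by
    have := (le_div_iff₀ (by positivity)).1 (hN.trans (min_le_right _ _))
    nlinarith [mul_nonneg hN0 hX0.le]
  have hN3 : X * (|T₀| * ε' * B') ≤ ε / 2 := by
    have h : ε' * (2 * X * (|T₀| * B' + 1)) = ε := by rw [hε']; field_simp
    nlinarith [mul_nonneg hε'0.le hX0.le]
  -- The first order variation of `c₀`. As M t carries v (c₀ 0) to v (c₀ t), the term linear in t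
  -- produces the inhomogeneity (T - T₀) v (c₀ t) due to the change of speed.
  set w : ℝ → F := fun t => M t (c 0 - c₀ 0 + (t * (T - T₀)) • v (c₀ 0)) with hw
  have hwle : ∀ t ∈ Icc (0 : ℝ) 1, ‖w t‖ ≤ B' * N := fun t ht => by
    refine ((M t).le_opNorm _).trans ?_
    rw [hB', mul_assoc]
    refine mul_le_mul (hB t ht) ?_ (norm_nonneg _) hB0
    refine (norm_add_le _ _).trans ?_
    rw [norm_smul, Real.norm_eq_abs, abs_mul, abs_of_nonneg ht.1]
    have h1 : t * |T - T₀| * ‖v (c₀ 0)‖ ≤ 1 * |T - T₀| * L := by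
      have := ht.2
      have := hL (c₀ 0)
      gcongr
    have := mul_nonneg hL0 (norm_nonneg (c 0 - c₀ 0))
    have := abs_nonneg (T - T₀)
    have := norm_nonneg (c 0 - c₀ 0)
    rw [hNdef]; nlinarith
  have hwd : ∀ t ∈ Icc (0 : ℝ) 1, HasDerivWithinAt w
      (T₀ • fderiv ℝ v (c₀ t) (w t) + (T - T₀) • v (c₀ t)) (Icc 0 1) t := fun t ht => by
    have h1 : HasDerivWithinAt (fun t : ℝ => c 0 - c₀ 0 + (t * (T - T₀)) • v (c₀ 0))
        ((T - T₀) • v (c₀ 0)) (Icc 0 1) t := by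
      have := (((hasDerivWithinAt_id t (Icc (0 : ℝ) 1)).mul_const (T - T₀)).smul_const
        (v (c₀ 0))).const_add (c 0 - c₀ 0)
      simpa using this
    have h2 := (hM t ht).clm_apply h1
    rw [(M t).map_smul, hMv t ht] at h2
    exact h2
  have hmain := norm_le_of_deriv_bound_unitInterval (f := fun t => c t - c₀ t - w t) (K := K₁)
    (ε := |T₀| * (ε' * (B' * N)) + |T - T₀| * (K * (C * N))) (by linarith) (by positivity)
    le_rfl (fun t ht => ((hc t ht).sub (hc₀ t ht)).sub (hwd t ht)) (by simp [hw, hM0])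
    (fun t ht => by
      -- The three terms are the Grönwall feedback, the linearization error of v, and a product of
      -- two small differences.
      have e : T • v (c t) - T₀ • v (c₀ t) -
          (T₀ • fderiv ℝ v (c₀ t) (w t) + (T - T₀) • v (c₀ t)) =
          T₀ • (v (c t) - v (c₀ t + w t)) +
          T₀ • (v (c₀ t + w t) - v (c₀ t) - fderiv ℝ v (c₀ t) (w t)) +
          (T - T₀) • (v (c t) - v (c₀ t)) := by module
      rw [e]
      refine (norm_add₃_le).trans ?_
      rw [norm_smul, norm_smul, norm_smul, Real.norm_eq_abs, Real.norm_eq_abs]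
      have h1 := hK.dist_le_mul (c t) (c₀ t + w t)
      rw [dist_eq_norm, dist_eq_norm, ← sub_sub] at h1
      have h2 := (hu (c₀ t) (w t) ((hwle t ht).trans hN1)).trans
        (mul_le_mul_of_nonneg_left (hwle t ht) hε'0.le)
      have h3 := hK.dist_le_mul (c t) (c₀ t)
      rw [dist_eq_norm, dist_eq_norm] at h3
      have h3' := h3.trans (mul_le_mul_of_nonneg_left (hC T c hc t ht) hKn)
      have h1' := mul_le_mul_of_nonneg_left h1 (abs_nonneg T₀)
      have h2' := mul_le_mul_of_nonneg_left h2 (abs_nonneg T₀)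
      have h3'' := mul_le_mul_of_nonneg_left h3' (abs_nonneg (T - T₀))
      have := norm_nonneg (c t - c₀ t - w t)
      rw [hK₁]
      nlinarith) 1 (by simp)
  have hw1 : w 1 = M 1 (c 0 - c₀ 0 + (T - T₀) • v (c₀ 0)) := by simp [hw]
  rw [← hw1]
  refine hmain.trans ?_
  rw [zero_add, ← hX]
  have hτ : |T - T₀| ≤ N := by rw [hNdef]; linarith [norm_nonneg (c 0 - c₀ 0)]
  have hE : |T₀| * (ε' * (B' * N)) + |T - T₀| * (K * (C * N)) ≤
      N * (|T₀| * ε' * B' + K * C * N) := by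
    have : |T - T₀| * (K * (C * N)) ≤ N * (K * (C * N)) := by gcongr
    linarith
  have hE2 : (|T₀| * (ε' * (B' * N)) + |T - T₀| * (K * (C * N))) / K₁ ≤
      N * (|T₀| * ε' * B' + K * C * N) := (div_le_self (by positivity) hK1).trans hE
  calc _ ≤ N * (|T₀| * ε' * B' + K * C * N) * X := by gcongr
    _ = N * (X * (|T₀| * ε' * B') + X * (K * C * N)) := by ring
    _ ≤ N * (ε / 2 + ε / 2) := by gcongr
    _ = ε * N := by ring

/-- Existence and first order expansion of the solutions of a `C¹` field on an open set, near a
given solution. -/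
lemma local_flow_expansion [FiniteDimensional ℝ F] {Ω : Set F} (hΩ : IsOpen Ω) {u : F → F}
    (hu : ContDiffOn ℝ 1 u Ω) {c₀ : ℝ → F} {T₀ : ℝ} (hmem : ∀ t ∈ Icc (0 : ℝ) 1, c₀ t ∈ Ω)
    (hc₀ : ∀ t ∈ Icc (0 : ℝ) 1, HasDerivWithinAt c₀ (T₀ • u (c₀ t)) (Icc 0 1) t) :
    ∃ M : ℝ → F →L[ℝ] F, M 0 = 1 ∧
      (∀ t ∈ Icc (0 : ℝ) 1,
        HasDerivWithinAt M ((T₀ • fderiv ℝ u (c₀ t)) ∘L M t) (Icc 0 1) t) ∧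
      (∀ t ∈ Icc (0 : ℝ) 1, M t (u (c₀ 0)) = u (c₀ t)) ∧
      ∀ ε > 0, ∃ δ > 0, ∀ (η : F) (T : ℝ), ‖η - c₀ 0‖ + |T - T₀| ≤ δ →
        ∃ c : ℝ → F, c 0 = η ∧ (∀ t ∈ Icc (0 : ℝ) 1, c t ∈ Ω) ∧
          (∀ t ∈ Icc (0 : ℝ) 1, HasDerivWithinAt c (T • u (c t)) (Icc 0 1) t) ∧
          (∀ t ∈ Icc (0 : ℝ) 1, ‖c t - c₀ t‖ ≤ ε) ∧
          ‖c 1 - c₀ 1 - M 1 (η - c₀ 0 + (T - T₀) • u (c₀ 0))‖ ≤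
            ε * (‖η - c₀ 0‖ + |T - T₀|) := by
  have hcomp : CompleteSpace F := FiniteDimensional.complete ℝ F
  have hcc : ContinuousOn c₀ (Icc 0 1) := fun t ht => (hc₀ t ht).continuousWithinAt
  obtain ⟨v, hv, hvs, ρ, hρ, hρΩ, hρe⟩ := exists_compactSupport_extension hΩ
    (isCompact_Icc.image_of_continuousOn hcc) (image_subset_iff.2 hmem) hu
  have hthick : ∀ t ∈ Icc (0 : ℝ) 1, ∀ y, ‖y - c₀ t‖ < ρ → y ∈ thickening ρ (c₀ '' Icc 0 1) :=
    fun t ht y hy => mem_thickening_iff.2 ⟨c₀ t, mem_image_of_mem _ ht, by rwa [dist_eq_norm]⟩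
  have hmem' : ∀ t ∈ Icc (0 : ℝ) 1, c₀ t ∈ thickening ρ (c₀ '' Icc 0 1) := fun t ht =>
    hthick t ht _ (by simpa using hρ)
  have hvu : ∀ t ∈ Icc (0 : ℝ) 1, v (c₀ t) = u (c₀ t) := fun t ht => hρe (hmem' t ht)
  have hdvu : ∀ t ∈ Icc (0 : ℝ) 1, fderiv ℝ v (c₀ t) = fderiv ℝ u (c₀ t) := fun t ht =>
    (hρe.eventuallyEq_of_mem (isOpen_thickening.mem_nhds (hmem' t ht))).fderiv_eq
  have hc₀v : ∀ t ∈ Icc (0 : ℝ) 1, HasDerivWithinAt c₀ (T₀ • v (c₀ t)) (Icc 0 1) t :=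
    fun t ht => by rw [hvu t ht]; exact hc₀ t ht
  have hAc : ContinuousOn (fun t => fderiv ℝ v (c₀ t)) (Icc 0 1) :=
    (hv.continuous_fderiv one_ne_zero).comp_continuousOn hcc
  -- The variational equation is a linear equation in the space of endomorphisms, with left
  -- composition as coefficient.
  obtain ⟨M, hM0, hM⟩ := exists_solution_linear
    (A := fun t => ContinuousLinearMap.compL ℝ F F F (T₀ • fderiv ℝ v (c₀ t)))
    ((ContinuousLinearMap.continuous _).comp_continuousOn (hAc.const_smul T₀)) 1
  have hM' : ∀ t ∈ Icc (0 : ℝ) 1,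
      HasDerivWithinAt M ((T₀ • fderiv ℝ v (c₀ t)) ∘L M t) (Icc 0 1) t := hM
  have h00 : (0 : ℝ) ∈ Icc (0 : ℝ) 1 := by simp
  refine ⟨M, hM0, fun t ht => by rw [← hdvu t ht]; exact hM' t ht, fun t ht => ?_, ?_⟩
  · rw [← hvu t ht, ← hvu 0 h00]
    exact variational_transport (A := fun t => fderiv ℝ v (c₀ t))
      (fun t _ => (hv.differentiable one_ne_zero _).hasFDerivAt) hAc hc₀v hM0 hM' t ht
  intro ε hε
  obtain ⟨K, hK⟩ := hv.lipschitzWith_of_hasCompactSupport hvs one_ne_zero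
  obtain ⟨L, hL⟩ := hvs.exists_bound_of_continuous hv.continuous
  obtain ⟨C, hC0, hC⟩ := solution_dist_le hK hL hc₀v
  obtain ⟨δ₁, hδ₁, hexp⟩ := solution_expansion hv hvs hc₀v hM0 hM' hε
  -- Within ρ/2 of `c₀` the fields v and u agree, so solutions for v are solutions for u.
  set ε₁ : ℝ := min ε (ρ / 2) with hε₁
  have hε₁0 : 0 < ε₁ := by positivity
  refine ⟨min δ₁ (ε₁ / (C + 1)), by positivity, fun η T hN => ?_⟩
  have hL0 : 0 ≤ L := (norm_nonneg _).trans (hL 0)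
  obtain ⟨c, hcη, hc⟩ := exists_solution_of_bounded_lipschitz (f := fun _ y => T • v y)
    (K := ‖T‖₊ * K) (L := (|T| * L).toNNReal)
    (fun t _ => (lipschitzWith_smul T).comp hK) (fun x => continuousOn_const)
    (fun t _ x => by
      rw [Real.coe_toNNReal _ (by positivity), norm_smul, Real.norm_eq_abs]
      exact mul_le_mul_of_nonneg_left (hL x) (abs_nonneg _)) η
  have hclose : ∀ t ∈ Icc (0 : ℝ) 1, ‖c t - c₀ t‖ ≤ ε₁ := fun t ht => by
    have h1 := hC T c hc t ht
    rw [hcη] at h1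
    have h2 := (le_div_iff₀ (by positivity)).1 (hN.trans (min_le_right _ _))
    have h3 : 0 ≤ ‖η - c₀ 0‖ + |T - T₀| := by positivity
    nlinarith
  have hin : ∀ t ∈ Icc (0 : ℝ) 1, c t ∈ thickening ρ (c₀ '' Icc 0 1) := fun t ht =>
    hthick t ht _ (by linarith [hclose t ht, min_le_right ε (ρ / 2)])
  refine ⟨c, hcη, fun t ht => hρΩ (hin t ht), fun t ht => ?_,
    fun t ht => (hclose t ht).trans (min_le_left _ _), ?_⟩
  · rw [← hρe (hin t ht)]; exact hc t ht
  · have := hexp T c hc (by rw [hcη]; exact hN.trans (min_le_left _ _))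
    rwa [hcη, hvu 0 h00] at this

/-- Uniqueness of solutions of a `C¹` field on an open set. -/
lemma solution_unique_of_contDiffOn [FiniteDimensional ℝ F] {Ω : Set F} (hΩ : IsOpen Ω)
    {u : F → F} (hu : ContDiffOn ℝ 1 u Ω) {a b : ℝ} {c d : ℝ → F}
    (hcΩ : ∀ t ∈ Icc a b, c t ∈ Ω) (hdΩ : ∀ t ∈ Icc a b, d t ∈ Ω)
    (hc : ∀ t ∈ Icc a b, HasDerivWithinAt c (u (c t)) (Icc a b) t)
    (hd : ∀ t ∈ Icc a b, HasDerivWithinAt d (u (d t)) (Icc a b) t) (h0 : c a = d a) :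
    EqOn c d (Icc a b) := by
  have hcc : ContinuousOn c (Icc a b) := fun t ht => (hc t ht).continuousWithinAt
  have hdc : ContinuousOn d (Icc a b) := fun t ht => (hd t ht).continuousWithinAt
  obtain ⟨v, hv, hvs, ρ, hρ, hρΩ, hρe⟩ := exists_compactSupport_extension hΩ
    ((isCompact_Icc.image_of_continuousOn hcc).union (isCompact_Icc.image_of_continuousOn hdc))
    (union_subset (image_subset_iff.2 hcΩ) (image_subset_iff.2 hdΩ)) hu
  obtain ⟨K, hK⟩ := hv.lipschitzWith_of_hasCompactSupport hvs one_ne_zero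
  have hcv : ∀ t ∈ Icc a b, v (c t) = u (c t) := fun t ht =>
    hρe (self_subset_thickening hρ _ (Or.inl (mem_image_of_mem _ ht)))
  have hdv : ∀ t ∈ Icc a b, v (d t) = u (d t) := fun t ht =>
    hρe (self_subset_thickening hρ _ (Or.inr (mem_image_of_mem _ ht)))
  intro t ht
  have := dist_le_of_trajectories_ODE (v := fun _ => v) (K := K) (fun _ => hK) hcc
    (fun t ht => by
      have ht' := Ico_subset_Icc_self ht
      rw [hcv t ht']
      exact (hc t ht').mono_of_mem_nhdsWithin (Icc_mem_nhdsGE_of_mem ht)) hdc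
    (fun t ht => by
      have ht' := Ico_subset_Icc_self ht
      rw [hdv t ht']
      exact (hd t ht').mono_of_mem_nhdsWithin (Icc_mem_nhdsGE_of_mem ht))
    (dist_le_zero.2 h0) t ht
  exact dist_le_zero.1 (by simpa using this)

end FlowTheory

/-! ### Liouville's formula. -/

/-- The determinant of an endomorphism of `ℝ³` in terms of its matrix entries. -/
lemma det_eq_entries (L : E3 →L[ℝ] E3) :
    L.det = (Matrix.of fun i j : Fin 3 => (L (EuclideanSpace.single j 1)) i).det := by
  rw [ContinuousLinearMap.det,
    ← LinearMap.det_toMatrix (EuclideanSpace.basisFun (Fin 3) ℝ).toBasis]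
  congr 1

/-- Liouville's formula for a traceless linear equation: the determinant of the fundamental
solution is constant. -/
lemma det_fundamental_solution {A M : ℝ → E3 →L[ℝ] E3} (hM0 : M 0 = 1)
    (hM : ∀ t ∈ Icc (0 : ℝ) 1, HasDerivWithinAt M (A t ∘L M t) (Icc 0 1) t)
    (htr : ∀ t ∈ Icc (0 : ℝ) 1, ∑ i : Fin 3, (A t (EuclideanSpace.single i 1)) i = 0) :
    ∀ t ∈ Icc (0 : ℝ) 1, (M t).det = 1 := by
  set m : Fin 3 → Fin 3 → ℝ → ℝ := fun i j t => (M t (EuclideanSpace.single j 1)) i with hm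
  have hdec : ∀ y : E3, y = ∑ k : Fin 3, y k • (EuclideanSpace.single k 1 : E3) := fun y => by
    ext i; fin_cases i <;> simp [Fin.sum_univ_three]
  have hmd : ∀ i j, ∀ t ∈ Icc (0 : ℝ) 1, HasDerivWithinAt (m i j)
      (∑ k, (A t (EuclideanSpace.single k 1)) i * m k j t) (Icc 0 1) t := fun i j t ht => by
    have h1 := (hM t ht).clm_apply (hasDerivWithinAt_const t (Icc (0 : ℝ) 1)
      (EuclideanSpace.single j 1 : E3))
    have h2 := (EuclideanSpace.proj i : E3 →L[ℝ] ℝ).hasFDerivAt.comp_hasDerivWithinAt t h1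
    have e : (A t (M t (EuclideanSpace.single j 1))) i =
        ∑ k, (A t (EuclideanSpace.single k 1)) i * m k j t := by
      conv_lhs => rw [hdec (M t (EuclideanSpace.single j 1))]
      simp [Fin.sum_univ_three, hm, mul_comm]
    rw [← e]
    simpa using! h2
  have hd := fun t ht => (((((((hmd 0 0 t ht).mul (hmd 1 1 t ht)).mul (hmd 2 2 t ht)).sub
    (((hmd 0 0 t ht).mul (hmd 1 2 t ht)).mul (hmd 2 1 t ht))).sub
    (((hmd 0 1 t ht).mul (hmd 1 0 t ht)).mul (hmd 2 2 t ht))).add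
    (((hmd 0 1 t ht).mul (hmd 1 2 t ht)).mul (hmd 2 0 t ht))).add
    (((hmd 0 2 t ht).mul (hmd 1 0 t ht)).mul (hmd 2 1 t ht))).sub
    (((hmd 0 2 t ht).mul (hmd 1 1 t ht)).mul (hmd 2 0 t ht))
  intro t ht
  have hdet : ∀ t, (M t).det = m 0 0 t * m 1 1 t * m 2 2 t - m 0 0 t * m 1 2 t * m 2 1 t
      - m 0 1 t * m 1 0 t * m 2 2 t + m 0 1 t * m 1 2 t * m 2 0 t
      + m 0 2 t * m 1 0 t * m 2 1 t - m 0 2 t * m 1 1 t * m 2 0 t := fun t => by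
    rw [det_eq_entries, Matrix.det_fin_three]
    simp [hm]
  have hd0 : ∀ t ∈ Icc (0 : ℝ) 1, HasDerivWithinAt (fun t => (M t).det - 1) 0 (Icc 0 1) t := by
    intro t ht
    refine (((hd t ht).congr_deriv ?_).congr (fun s _ => ?_) ?_).sub_const 1
    -- The derivative of det M is tr A · det M; the factor of `h` below is det M.
    · have h := htr t ht
      simp only [Fin.sum_univ_three] at h ⊢
      simp only [Pi.mul_apply]
      linear_combination (m 0 0 t * m 1 1 t * m 2 2 t - m 0 0 t * m 1 2 t * m 2 1 t
        - m 0 1 t * m 1 0 t * m 2 2 t + m 0 1 t * m 1 2 t * m 2 0 t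
        + m 0 2 t * m 1 0 t * m 2 1 t - m 0 2 t * m 1 1 t * m 2 0 t) * h
    · exact hdet s
    · exact hdet t
  have := norm_le_of_deriv_bound_unitInterval one_pos le_rfl le_rfl hd0
    (by simp [hM0, ContinuousLinearMap.det])
    (fun s _ => by simp) t ht
  rw [zero_div, add_zero, zero_mul, norm_le_zero_iff] at this
  linarith

/-! ### The derivative of starting point plus time times velocity. -/

/-- The derivative of the Euclidean norm away from the origin. -/
lemma hasFDerivAt_norm_E3 {x : E3} (hx : x ≠ 0) :
    HasFDerivAt (fun y : E3 => ‖y‖) (innerSL ℝ (nHat x)) x := by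
  have h1 := (hasStrictFDerivAt_norm_sq x).hasFDerivAt.sqrt (by simpa using hx)
  simp only [Real.sqrt_sq (norm_nonneg _)] at h1
  refine h1.congr_fderiv ?_
  ext v
  have : ‖x‖ ≠ 0 := by simpa using hx
  simp [nHat]
  field_simp

/-- The derivative of `x ↦ (α / |x|) x + |x| w`. -/
def coneDeriv (α : ℝ) (x w : E3) : E3 →L[ℝ] E3 :=
  (α / ‖x‖) • (ContinuousLinearMap.id ℝ E3 +
    (innerSL ℝ (nHat x)).smulRight ((‖x‖ / α) • w - nHat x))

/-- This is the combination to which M is applied in the expansion of the flow, with w the velocity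
at the starting point. For w = 0 it is the radial projection. -/
lemma hasFDerivAt_cone {α : ℝ} (hα : 0 < α) {x : E3} (hx : x ≠ 0) (w : E3) (a : ℝ) :
    HasFDerivAt (fun y : E3 => (α / ‖y‖) • y + (‖y‖ - a) • w) (coneDeriv α x w) x := by
  have hn : ‖x‖ ≠ 0 := by simpa using hx
  have h1 := hasFDerivAt_norm_E3 hx
  have h2 := ((hasDerivAt_inv hn).const_mul α).comp_hasFDerivAt x h1
  have h3 := (h2.smul (hasFDerivAt_id x)).add ((h1.sub_const a).smul_const w)
  refine (h3.congr_fderiv ?_).congr_of_eventuallyEq (Eventually.of_forall fun y => ?_)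
  · ext1 v
    simp [coneDeriv, nHat]
    match_scalars <;> field_simp
  · simp [div_eq_mul_inv]

/-- The map is α/|x| times a transvection, whose determinant is (|x|/α) ⟨w, n⟩. Geometrically, two
tangential directions shrink by α/|x| and the radial one goes to w. -/
lemma det_coneDeriv {α : ℝ} (hα : 0 < α) {x : E3} (hx : x ≠ 0) (w : E3) :
    (coneDeriv α x w).det = (α / ‖x‖) ^ 2 * inner ℝ w (nHat x) := by
  have hn : ‖x‖ ≠ 0 := by simpa using hx
  have e : ((coneDeriv α x w : E3 →L[ℝ] E3) : E3 →ₗ[ℝ] E3) = (α / ‖x‖) •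
      LinearMap.transvection (innerSL ℝ (nHat x) : E3 →ₗ[ℝ] ℝ) ((‖x‖ / α) • w - nHat x) := by
    ext1 v
    simp [coneDeriv, LinearMap.transvection.apply]
  have hnn : inner ℝ (nHat x) (nHat x) = 1 := by
    rw [real_inner_self_eq_norm_sq, nHat, norm_smul, norm_inv, norm_norm, inv_mul_cancel₀ hn, one_pow]
  rw [ContinuousLinearMap.det, e, LinearMap.det_smul, LinearMap.transvection.det]
  simp only [finrank_euclideanSpace, Fintype.card_fin, ContinuousLinearMap.coe_coe,
    innerSL_apply_apply, inner_sub_right, inner_smul_right, hnn, real_inner_comm w]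
  field_simp
  ring

/-! ### The flow tube and its end point map. -/

/-- `c` is the streamline from the radial projection of `x` to `∂B_α`, followed for the time
`|x| - α` and parametrized by the unit interval. -/
def IsRescaledStreamline (D : Set E3) (u : E3 → E3) (α : ℝ) (x : E3) (c : ℝ → E3) : Prop :=
  IsStreamline D (fun y => (‖x‖ - α) • u y) ((α / ‖x‖) • x) 1 c

/-- The points `x` outside `B_α` whose radial projection to `∂B_α` is an inflow point and whose
streamline stays in `B_α` for the time `|x| - α`. -/
def flowTube (D : Set E3) (u : E3 → E3) (α : ℝ) : Set E3 :=
  {x | α < ‖x‖ ∧ inner ℝ (u ((α / ‖x‖) • x)) x < 0 ∧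
    ∃ c : ℝ → E3, IsRescaledStreamline D u α x c ∧ ∀ t ∈ Ioc (0 : ℝ) 1, c t ∈ ball (0 : E3) α}

open Classical in
/-- The end point of the streamline from the radial projection of `x` to `∂B_α` at the time
`|x| - α`. -/
def tubeMap (D : Set E3) (u : E3 → E3) (α : ℝ) (x : E3) : E3 :=
  if h : ∃ c, IsRescaledStreamline D u α x c then h.choose 1 else 0

section Tube

variable {D : Set E3} {u : E3 → E3} {α : ℝ}

lemma isOpen_punctured (hD : IsOpen D) : IsOpen (D \ {0}) := hD.sdiff isClosed_singleton

/-- Uniqueness of solutions makes the choice in `tubeMap` immaterial. -/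
lemma tubeMap_eq (hD : IsOpen D) (hu : ContDiffOn ℝ 1 u (D \ {0})) {x : E3} {c : ℝ → E3}
    (hc : IsRescaledStreamline D u α x c) : tubeMap D u α x = c 1 := by
  have h : ∃ c, IsRescaledStreamline D u α x c := ⟨c, hc⟩
  rw [tubeMap, dif_pos h]
  obtain ⟨h1, h2, h3⟩ := h.choose_spec
  exact solution_unique_of_contDiffOn (isOpen_punctured hD) (hu.const_smul (‖x‖ - α))
    h2 hc.2.1 h3 hc.2.2 (h1.trans hc.1.symm) (by simp)

/-- The distance of the initial data (initial point and time) of two rescaled streamlines. -/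
lemma tendsto_initial_data (hα : 0 < α) {x : E3} (hx : x ≠ 0) :
    (fun y : E3 => ‖(α / ‖y‖) • y - (α / ‖x‖) • x‖ + |(‖y‖ - α) - (‖x‖ - α)|)
      =O[𝓝 x] (fun y => y - x) ∧
    Tendsto (fun y : E3 => ‖(α / ‖y‖) • y - (α / ‖x‖) • x‖ + |(‖y‖ - α) - (‖x‖ - α)|)
      (𝓝 x) (𝓝 0) := by
  have h1 := (hasFDerivAt_cone hα hx 0 0).isBigO_sub
  have h2 := ((hasFDerivAt_norm_E3 hx).sub_const α).isBigO_sub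
  simp only [smul_zero, add_zero] at h1
  have h3 := h1.norm_left.add h2.norm_left
  refine ⟨h3, h3.trans_tendsto ?_⟩
  have : Tendsto (fun y : E3 => y - x) (𝓝 x) (𝓝 (x - x)) := (continuous_id.sub continuous_const).tendsto x
  simpa using this

lemma exists_near_rescaledStreamline (hD : IsOpen D) (hu : ContDiffOn ℝ 1 u (D \ {0}))
    (hα : 0 < α) {x : E3} (hx : x ≠ 0) {c : ℝ → E3} (hc : IsRescaledStreamline D u α x c)
    {ε : ℝ} (hε : 0 < ε) :
    ∀ᶠ y in 𝓝 x, ∃ d, IsRescaledStreamline D u α y d ∧ ∀ t ∈ Icc (0 : ℝ) 1, ‖d t - c t‖ ≤ ε := by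
  obtain ⟨M, -, -, -, hexp⟩ := local_flow_expansion (isOpen_punctured hD) hu hc.2.1 hc.2.2
  obtain ⟨δ, hδ, h⟩ := hexp ε hε
  rw [hc.1] at h
  filter_upwards [(tendsto_initial_data hα hx).2.eventually (ge_mem_nhds hδ)] with y hy
  obtain ⟨d, hd0, hdm, hd, hdε, -⟩ := h _ _ hy
  exact ⟨d, ⟨hd0, hdm, hd⟩, hdε⟩

/-- The derivative of the end point map has an explicit determinant when `u` is solenoidal. -/
lemma exists_hasFDerivAt_tubeMap (hD : IsOpen D) (hu : ContDiffOn ℝ 1 u (D \ {0}))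
    (hdiv : ∀ x ∈ D \ {0}, divergence u x = 0) (hα : 0 < α) {x : E3} (hx : x ≠ 0) {c : ℝ → E3}
    (hc : IsRescaledStreamline D u α x c) :
    ∃ L : E3 →L[ℝ] E3, HasFDerivAt (tubeMap D u α) L x ∧
      L.det = (α / ‖x‖) ^ 2 * inner ℝ (u ((α / ‖x‖) • x)) (nHat x) := by
  obtain ⟨M, hM0, hM, -, hexp⟩ := local_flow_expansion (isOpen_punctured hD) hu hc.2.1 hc.2.2
  have hc0 := hc.1
  rw [hc0] at hexp
  set η := (α / ‖x‖) • x with hη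
  -- Incompressibility enters here: the variational equation has trace (|x| - α) div u = 0.
  have hdet : (M 1).det = 1 := det_fundamental_solution hM0 hM (fun t ht => by
    have := hdiv _ (hc.2.1 t ht)
    rw [divergence] at this
    simp only [smul_apply, PiLp.smul_apply, smul_eq_mul, ← Finset.mul_sum,
      this, mul_zero]) 1 (by simp)
  refine ⟨M 1 ∘L coneDeriv α x (u η), ?_, ?_⟩
  swap
  · have := LinearMap.det_comp (M 1 : E3 →ₗ[ℝ] E3) (coneDeriv α x (u η) : E3 →ₗ[ℝ] E3)
    rw [ContinuousLinearMap.det, ContinuousLinearMap.toLinearMap_comp, this]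
    change (M 1).det * (coneDeriv α x (u η)).det = _
    rw [hdet, one_mul, det_coneDeriv hα hx]
  -- The linear model of the flow composed with the initial data; `h2` shows that `tubeMap` follows
  -- it up to o(y - x).
  have h1 : HasFDerivAt (fun y : E3 => M 1 ((α / ‖y‖) • y + (‖y‖ - α) • u η))
      (M 1 ∘L coneDeriv α x (u η)) x :=
    (M 1).hasFDerivAt.comp x (hasFDerivAt_cone hα hx (u η) α)
  obtain ⟨hO, hT⟩ := tendsto_initial_data hα hx
  have h2 : (fun y => tubeMap D u α y - tubeMap D u α x -
      M 1 ((α / ‖y‖) • y - η + ((‖y‖ - α) - (‖x‖ - α)) • u η)) =o[𝓝 x] fun y => y - x := by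
    refine Asymptotics.IsLittleO.trans_isBigO ?_ hO
    rw [Asymptotics.isLittleO_iff]
    intro ε hε
    obtain ⟨δ, hδ, h⟩ := hexp ε hε
    filter_upwards [hT.eventually (ge_mem_nhds hδ)] with y hy
    obtain ⟨d, hd0, hdm, hd, -, hde⟩ := h _ _ hy
    rw [tubeMap_eq hD hu (x := y) ⟨hd0, hdm, hd⟩, tubeMap_eq hD hu hc]
    refine hde.trans (le_of_eq ?_)
    rw [Real.norm_of_nonneg (by positivity)]
  rw [hasFDerivAt_iff_isLittleO] at h1 ⊢
  refine (h2.add h1).congr_left fun y => ?_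
  rw [← map_sub]
  have : (α / ‖y‖) • y - η + ((‖y‖ - α) - (‖x‖ - α)) • u η =
      (α / ‖y‖) • y + (‖y‖ - α) • u η - ((α / ‖x‖) • x + (‖x‖ - α) • u η) := by
    rw [← hη]; module
  rw [this]
  abel

/-- A curve which starts on `∂B_α` and moves inwards enters `B_α`. -/
lemma norm_lt_of_inward {T δ : ℝ} (hT : 0 < T) (hδ : δ ≤ 1) {d : ℝ → E3}
    (hd : ∀ t ∈ Icc (0 : ℝ) 1, HasDerivWithinAt d (T • u (d t)) (Icc 0 1) t)
    (hin : ∀ t ∈ Icc 0 δ, inner ℝ (d t) (u (d t)) < 0) :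
    ∀ t ∈ Ioc 0 δ, ‖d t‖ < ‖d 0‖ := by
  have hanti : StrictAntiOn (fun t => ‖d t‖ ^ 2) (Icc 0 δ) := by
    refine strictAntiOn_of_deriv_neg (convex_Icc 0 δ) (fun t ht => ?_) (fun t ht => ?_)
    · exact ((hd t ⟨ht.1, ht.2.trans hδ⟩).norm_sq.continuousWithinAt).mono
        (Icc_subset_Icc_right hδ)
    · rw [interior_Icc] at ht
      have h1 := ((hd t ⟨ht.1.le, ht.2.le.trans hδ⟩).norm_sq).hasDerivAt
        (Icc_mem_nhds ht.1 (ht.2.trans_le hδ))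
      rw [h1.deriv, inner_smul_right]
      have := hin t ⟨ht.1.le, ht.2.le⟩
      nlinarith
  intro t ht
  have := hanti (left_mem_Icc.2 (ht.1.le.trans ht.2)) ⟨ht.1.le, ht.2⟩ ht.1
  exact lt_of_pow_lt_pow_left₀ 2 (norm_nonneg _) this

lemma norm_radial_projection (hα : 0 < α) {x : E3} (hx : x ≠ 0) : ‖(α / ‖x‖) • x‖ = α := by
  have : ‖x‖ ≠ 0 := by simpa using hx
  rw [norm_smul, Real.norm_of_nonneg (by positivity), div_mul_cancel₀ _ this]

/-- The half-open time interval is not compact. Up to a small time δ, strict inflow persists for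
nearby curves and pushes them inside; on [δ, 1] the curve keeps a positive distance κ from the
sphere. -/
lemma isOpen_flowTube (hD : IsOpen D) (hu : ContDiffOn ℝ 1 u (D \ {0})) (hα : 0 < α) :
    IsOpen (flowTube D u α) := by
  rw [isOpen_iff_mem_nhds]
  rintro x ⟨hxα, hxu, c, hc, hcb⟩
  have hxn : 0 < ‖x‖ := hα.trans hxα
  have hx : x ≠ 0 := norm_pos_iff.1 hxn
  have hΩ := isOpen_punctured hD
  set η := (α / ‖x‖) • x with hη
  have hc0 : c 0 = η := hc.1
  have hηΩ : η ∈ D \ {0} := hc0 ▸ hc.2.1 0 (by simp)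
  have hcc : ContinuousOn c (Icc 0 1) := fun t ht => (hc.2.2 t ht).continuousWithinAt
  have huη : ContinuousAt u η := (hu.contDiffAt (hΩ.mem_nhds hηΩ)).continuousAt
  have hcone : ContinuousAt (fun y : E3 => (α / ‖y‖) • y) x := by
    have := (hasFDerivAt_cone hα hx 0 0).continuousAt
    simpa using this
  have hin : ∀ᶠ y in 𝓝 η, inner ℝ y (u y) < 0 := by
    have h1 : ContinuousAt (fun y => inner ℝ y (u y)) η := continuousAt_id.inner huη
    refine h1.eventually (gt_mem_nhds ?_)
    change inner ℝ η (u η) < 0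
    rw [real_inner_comm]
    conv_lhs => rw [hη]
    rw [inner_smul_right]
    exact mul_neg_of_pos_of_neg (by positivity) hxu
  obtain ⟨ρ, hρ, hρin⟩ := Metric.eventually_nhds_iff.1 hin
  obtain ⟨δ, hδ, hδ1, hδc⟩ : ∃ δ > 0, δ ≤ 1 ∧ ∀ t ∈ Icc 0 δ, dist (c t) η < ρ / 2 := by
    obtain ⟨δ, hδ, h⟩ := Metric.continuousWithinAt_iff.1 (hcc 0 (by simp)) (ρ / 2) (by linarith)
    refine ⟨min (δ / 2) 1, by positivity, min_le_right _ _, fun t ht => ?_⟩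
    rw [← hc0]
    refine h ⟨ht.1, ht.2.trans (min_le_right _ _)⟩ ?_
    rw [Real.dist_eq, sub_zero, abs_of_nonneg ht.1]
    linarith [ht.2, min_le_left (δ / 2) 1]
  obtain ⟨κ, hκ, hκc⟩ : ∃ κ > 0, ∀ t ∈ Icc δ 1, ‖c t‖ + κ ≤ α := by
    obtain ⟨t₀, ht₀, hmax⟩ := isCompact_Icc.exists_isMaxOn (nonempty_Icc.2 hδ1)
      ((hcc.mono (Icc_subset_Icc_left hδ.le)).norm)
    have := hcb t₀ ⟨hδ.trans_le ht₀.1, ht₀.2⟩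
    rw [mem_ball_zero_iff] at this
    refine ⟨α - ‖c t₀‖, by linarith, fun t ht => ?_⟩
    have h : ‖c t‖ ≤ ‖c t₀‖ := hmax ht
    linarith
  have hεpos : 0 < min (ρ / 4) (κ / 2) := by positivity
  have e1 : ∀ᶠ y in 𝓝 x, α < ‖y‖ := continuous_norm.continuousAt.eventually (lt_mem_nhds hxα)
  have e2 : ∀ᶠ y in 𝓝 x, inner ℝ (u ((α / ‖y‖) • y)) y < 0 := by
    have h1 : ContinuousAt (fun y : E3 => inner ℝ (u ((α / ‖y‖) • y)) y) x :=
      (ContinuousAt.comp (f := fun y : E3 => (α / ‖y‖) • y) (g := u) huη hcone).inner continuousAt_id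
    exact h1.eventually (gt_mem_nhds hxu)
  filter_upwards [e1, e2, exists_near_rescaledStreamline hD hu hα hx hc hεpos] with y hy1 hy2 hy3
  obtain ⟨d, hd, hdc⟩ := hy3
  refine ⟨hy1, hy2, d, hd, fun t ht => ?_⟩
  rw [mem_ball_zero_iff]
  rcases le_total t δ with htδ | htδ
  · have hd0 : ‖d 0‖ = α := by
      rw [hd.1]
      exact norm_radial_projection hα (norm_pos_iff.1 (hα.trans hy1))
    rw [← hd0]
    refine norm_lt_of_inward (T := ‖y‖ - α) (by linarith) hδ1 hd.2.2 (fun s hs => ?_) t ⟨ht.1, htδ⟩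
    refine hρin ?_
    have h1 := hdc s ⟨hs.1, hs.2.trans hδ1⟩
    rw [← dist_eq_norm] at h1
    have h2 := hδc s hs
    have := dist_triangle (d s) (c s) η
    have := min_le_left (ρ / 4) (κ / 2)
    linarith
  · have h1 := hdc t ⟨ht.1.le, ht.2⟩
    have h2 := hκc t ⟨htδ, ht.2⟩
    have h3 := norm_sub_norm_le (d t) (c t)
    have := min_le_right (ρ / 4) (κ / 2)
    linarith

/-- Reversing and unscaling a rescaled streamline. -/
lemma hasDerivWithinAt_reversed {T s : ℝ} (hT : 0 < T) (hs : s ≤ T) {c : ℝ → E3}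
    (hc : ∀ t ∈ Icc (0 : ℝ) 1, HasDerivWithinAt c (T • u (c t)) (Icc 0 1) t) :
    ∀ t ∈ Icc 0 s, 1 - t / T ∈ Icc (0 : ℝ) 1 ∧
      HasDerivWithinAt (fun t => c (1 - t / T)) (-u (c (1 - t / T))) (Icc 0 s) t := by
  have hmaps : MapsTo (fun t => 1 - t / T) (Icc 0 s) (Icc (0 : ℝ) 1) := fun t ht =>
    ⟨sub_nonneg.2 ((div_le_one hT).2 (ht.2.trans hs)), by
      have := div_nonneg ht.1 hT.le
      linarith⟩
  intro t ht
  refine ⟨hmaps ht, ?_⟩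
  have h1 : HasDerivWithinAt (fun t => 1 - t / T) (-(1 / T)) (Icc 0 s) t :=
    ((hasDerivWithinAt_id t _).div_const T).const_sub 1
  refine ((hc _ (hmaps ht)).scomp t h1 hmaps).congr_deriv ?_
  rw [smul_smul]
  field_simp
  simp

/-- Run backwards from a common end point, the two curves agree for the shorter of the two times.
The shorter one is then on ∂B_α, whereas a strictly longer one would still be in the open ball. -/
lemma injOn_tubeMap (hD : IsOpen D) (hu : ContDiffOn ℝ 1 u (D \ {0})) (hα : 0 < α) :
    InjOn (tubeMap D u α) (flowTube D u α) := by
  have key : ∀ x ∈ flowTube D u α, ∀ y ∈ flowTube D u α, tubeMap D u α x = tubeMap D u α y →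
      ‖x‖ ≤ ‖y‖ → x = y := by
    rintro x ⟨hx1, -, c, hc, hcb⟩ y ⟨hy1, -, d, hd, hdb⟩ heq hle
    rw [tubeMap_eq hD hu hc, tubeMap_eq hD hu hd] at heq
    have hx0 : x ≠ 0 := norm_pos_iff.1 (hα.trans hx1)
    have hTx : 0 < ‖x‖ - α := by linarith
    have hTy : 0 < ‖y‖ - α := by linarith
    have h1 := hasDerivWithinAt_reversed hTx le_rfl hc.2.2
    have h2 := hasDerivWithinAt_reversed (s := ‖x‖ - α) hTy (by linarith) hd.2.2
    have h3 := solution_unique_of_contDiffOn (isOpen_punctured hD) hu.neg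
      (fun t ht => hc.2.1 _ (h1 t ht).1) (fun t ht => hd.2.1 _ (h2 t ht).1)
      (fun t ht => (h1 t ht).2) (fun t ht => (h2 t ht).2) (by simpa using heq)
      (right_mem_Icc.2 hTx.le)
    simp only [div_self hTx.ne', sub_self] at h3
    rw [hc.1] at h3
    have hnorm := norm_radial_projection hα hx0
    rcases hle.lt_or_eq with hlt | heqn
    · exfalso
      have h4 : 1 - (‖x‖ - α) / (‖y‖ - α) ∈ Ioc (0 : ℝ) 1 :=
        ⟨sub_pos.2 ((div_lt_one hTy).2 (by linarith)), by
          have := div_nonneg hTx.le hTy.le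
          linarith⟩
      have := hdb _ h4
      rw [← h3, mem_ball_zero_iff, hnorm] at this
      exact lt_irrefl _ this
    · rw [heqn, div_self hTy.ne', sub_self, hd.1, ← heqn] at h3
      exact smul_right_injective E3 (div_pos hα (hα.trans hx1)).ne' h3
  intro x hx y hy h
  rcases le_total ‖x‖ ‖y‖ with hle | hle
  · exact key x hx y hy h hle
  · exact (key y hy x hx h.symm hle).symm

/-- A point on a streamline which enters `B_α` is in the range of the tube map. -/
lemma mem_flowTube_of_isStreamline (hD : IsOpen D) (hu : ContDiffOn ℝ 1 u (D \ {0})) (hα : 0 < α)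
    {ω : E3} (hω : ‖ω‖ = 1) (hin : inner ℝ (u (α • ω)) ω < 0) {s : ℝ} {γ : ℝ → E3}
    (hγ : IsStreamline D u (α • ω) s γ) (hb : ∀ t ∈ Ioo 0 s, γ t ∈ ball (0 : E3) α) {t : ℝ}
    (ht : t ∈ Ioo 0 s) :
    (t + α) • ω ∈ flowTube D u α ∧ tubeMap D u α ((t + α) • ω) = γ t := by
  have htα : 0 < t + α := add_pos ht.1 hα
  have hnorm : ‖(t + α) • ω‖ = t + α := by
    rw [norm_smul, hω, mul_one, Real.norm_of_nonneg htα.le]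
  have hproj : (α / ‖(t + α) • ω‖) • ((t + α) • ω) = α • ω := by
    rw [hnorm, smul_smul, div_mul_cancel₀ _ htα.ne']
  have hmaps : MapsTo (fun τ => τ * t) (Icc (0 : ℝ) 1) (Icc 0 s) := fun τ hτ =>
    ⟨mul_nonneg hτ.1 ht.1.le, by nlinarith [hτ.2, ht.1, ht.2]⟩
  have hc : IsRescaledStreamline D u α ((t + α) • ω) (fun τ => γ (τ * t)) := by
    rw [IsRescaledStreamline, hproj, hnorm, add_sub_cancel_right]
    refine ⟨by simpa using hγ.1, fun τ hτ => hγ.2.1 _ (hmaps hτ), fun τ hτ => ?_⟩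
    have h1 : HasDerivWithinAt (fun τ => τ * t) t (Icc (0 : ℝ) 1) τ := by
      simpa using (hasDerivWithinAt_id τ (Icc (0 : ℝ) 1)).mul_const t
    exact (hγ.2.2 _ (hmaps hτ)).scomp τ h1 hmaps
  refine ⟨⟨by rw [hnorm]; linarith [ht.1], ?_, _, hc, fun τ hτ => ?_⟩, ?_⟩
  · rw [hproj, inner_smul_right]
    exact mul_neg_of_pos_of_neg htα hin
  · exact hb _ ⟨mul_pos hτ.1 ht.1, by nlinarith [hτ.2, ht.1, ht.2]⟩
  · rw [tubeMap_eq hD hu hc, one_mul]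

end Tube

/-! ### Polar coordinates and streamlines entering a ball. -/

/-- Integration in polar coordinates on `ℝ³`. -/
lemma lintegral_polar_E3 {g : E3 → ENNReal} (hg : Measurable g) :
    ∫⁻ x, g x = ∫⁻ ω : sphere (0 : E3) 1, (∫⁻ ρ in Ioi (0 : ℝ),
      ENNReal.ofReal (ρ ^ 2) * g (ρ • (ω : E3))) ∂(volume : Measure E3).toSphere := by
  have hmp := (volume : Measure E3).measurePreserving_homeomorphUnitSphereProd
  have hmeas : Measurable (fun p : sphere (0 : E3) 1 × Ioi (0 : ℝ) => g ((p.2 : ℝ) • (p.1 : E3))) :=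
    hg.comp (by fun_prop)
  have h1 : ∫⁻ x, g x = ∫⁻ x : ({(0 : E3)}ᶜ : Set E3), g x ∂(volume.comap Subtype.val) := by
    rw [lintegral_subtype_comap (measurableSet_singleton _).compl, restrict_compl_singleton]
  have h2 : ∫⁻ x : ({(0 : E3)}ᶜ : Set E3), g x ∂(volume.comap Subtype.val) =
      ∫⁻ p, g ((p.2 : ℝ) • (p.1 : E3)) ∂((volume : Measure E3).toSphere.prod
        (Measure.volumeIoiPow (Module.finrank ℝ E3 - 1))) := by
    rw [← hmp.lintegral_comp hmeas]
    refine lintegral_congr fun x => ?_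
    have : ‖(x : E3)‖ ≠ 0 := norm_ne_zero_iff.2 x.2
    simp [smul_smul, this]
  rw [h1, h2, lintegral_prod _ hmeas.aemeasurable]
  refine lintegral_congr fun ω => ?_
  have h3 : Measurable fun ρ : Ioi (0 : ℝ) => g ((ρ : ℝ) • (ω : E3)) := hg.comp (by fun_prop)
  rw [Measure.volumeIoiPow, lintegral_withDensity_eq_lintegral_mul _ (by fun_prop) h3]
  rw [← lintegral_subtype_comap measurableSet_Ioi]
  simp

/-- The length, inside `B_ε`, of a streamline which starts outside `B_ε` and reaches `B_r`. -/
lemma le_lintegral_speed {D : Set E3} {u : E3 → E3} (hu : ContDiffOn ℝ 1 u (D \ {0}))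
    {η : E3} {s r ε : ℝ} (hs : 0 < s) (hrε : r < ε) (hη : ε ≤ ‖η‖) {γ : ℝ → E3}
    (hγ : IsStreamline D u η s γ) (hr : γ s ∈ ball (0 : E3) r) :
    ENNReal.ofReal (ε - r) ≤
      ∫⁻ t in Ioo 0 s, (ball (0 : E3) ε).indicator (fun y => ‖u y‖ₑ) (γ t) := by
  rw [mem_ball_zero_iff] at hr
  have hγc : ContinuousOn γ (Icc 0 s) := fun t ht => (hγ.2.2 t ht).continuousWithinAt
  have huc : ContinuousOn (fun t => u (γ t)) (Icc 0 s) := hu.continuousOn.comp hγc hγ.2.1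
  have hK : IsCompact (Icc 0 s ∩ (fun t => ‖γ t‖) ⁻¹' Ici ε) :=
    isCompact_Icc.of_isClosed_subset (hγc.norm.preimage_isClosed_of_isClosed isClosed_Icc isClosed_Ici)
      inter_subset_left
  -- The last time outside B_ε; from then on the curve stays in B_ε and its displacement is at least
  -- ε - r.
  obtain ⟨τ, ⟨hτ, hτε⟩, hτmax⟩ := hK.exists_isGreatest ⟨0, ⟨by simp [hs.le], by
    simpa [hγ.1] using hη⟩⟩
  have hτε' : ε ≤ ‖γ τ‖ := hτε
  have hτs : τ < s := lt_of_le_of_ne hτ.2 (by rintro rfl; linarith)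
  have hin : ∀ t ∈ Ioo τ s, γ t ∈ ball (0 : E3) ε := fun t ht => by
    rw [mem_ball_zero_iff]
    by_contra hcon
    have := hτmax ⟨⟨hτ.1.trans ht.1.le, ht.2.le⟩, not_lt.1 hcon⟩
    linarith [ht.1]
  have hsub : Icc τ s ⊆ Icc 0 s := Icc_subset_Icc_left hτ.1
  have hint : ∫ t in τ..s, u (γ t) = γ s - γ τ := by
    refine intervalIntegral.integral_eq_sub_of_hasDerivAt_of_le hτs.le (hγc.mono hsub)
      (fun t ht => ?_) ?_
    · exact (hγ.2.2 t (hsub (Ioo_subset_Icc_self ht))).hasDerivAt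
        (Icc_mem_nhds (hτ.1.trans_lt ht.1) ht.2)
    · exact (huc.mono (by rwa [uIcc_of_le hτs.le])).intervalIntegrable
  calc ENNReal.ofReal (ε - r) ≤ ‖γ s - γ τ‖ₑ := by
        rw [← ofReal_norm, norm_sub_rev]
        exact ENNReal.ofReal_le_ofReal (by linarith [norm_sub_norm_le (γ τ) (γ s)])
    _ ≤ ∫⁻ t in Ioo τ s, ‖u (γ t)‖ₑ := by
        rw [← hint, intervalIntegral.integral_of_le hτs.le, integral_Ioc_eq_integral_Ioo]
        exact enorm_integral_le_lintegral_enorm _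
    _ = ∫⁻ t in Ioo τ s, (ball (0 : E3) ε).indicator (fun y => ‖u y‖ₑ) (γ t) :=
        setLIntegral_congr_fun measurableSet_Ioo fun t ht => by
          simp only [indicator_of_mem (hin t ht)]
    _ ≤ _ := lintegral_mono_set (Ioo_subset_Ioo_left hτ.1)

/-- A streamline cannot enter `B_α` through an outflow point of `∂B_α`. -/
lemma inner_nonpos_of_isStreamline {D : Set E3} {u : E3 → E3} {η : E3} {s : ℝ} (hs : 0 < s)
    {γ : ℝ → E3} (hγ : IsStreamline D u η s γ)
    (hb : ∀ t ∈ Ioo 0 s, γ t ∈ ball (0 : E3) ‖η‖) : inner ℝ (u η) η ≤ 0 := by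
  have h1 := (hγ.2.2 0 ⟨le_rfl, hs.le⟩).norm_sq
  rw [hγ.1, hasDerivWithinAt_iff_tendsto_slope] at h1
  have hmem : Ioo 0 s ∈ 𝓝[>] (0 : ℝ) := Ioo_mem_nhdsGT hs
  have h2 := h1.mono_left (nhdsWithin_mono 0 (show Ioo 0 s ⊆ Icc 0 s \ {0} from
    fun t ht => ⟨Ioo_subset_Icc_self ht, ht.1.ne'⟩))
  rw [nhdsWithin_Ioo_eq_nhdsGT hs] at h2
  have h3 : 2 * inner ℝ η (u η) ≤ 0 := by
    refine le_of_tendsto h2 ?_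
    filter_upwards [hmem] with t ht
    have h4 := hb t ht
    rw [mem_ball_zero_iff] at h4
    rw [slope_def_field, hγ.1]
    refine div_nonpos_of_nonpos_of_nonneg ?_ (by linarith [ht.1])
    nlinarith [norm_nonneg (γ t)]
  rw [real_inner_comm]
  linarith

/-! ### The flux estimate. -/

section Flux

variable {D : Set E3} {u : E3 → E3} {α : ℝ}

/-- The part of the flow tube which is carried into `B_ε`. -/
lemma lintegral_tube_le (hD : IsOpen D) (hu : ContDiffOn ℝ 1 u (D \ {0}))
    (hdiv : ∀ x ∈ D \ {0}, divergence u x = 0) (hα : 0 < α) (ε : ℝ) :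
    ∃ g : E3 → ENNReal, Measurable g ∧ ∫⁻ x, g x ≤ ∫⁻ x in D ∩ ball 0 ε, ‖u x‖ₑ ∧
      ∀ x ∈ flowTube D u α, g x = ENNReal.ofReal
        ((α / ‖x‖) ^ 2 * |inner ℝ (u ((α / ‖x‖) • x)) (nHat x)|) *
          (ball (0 : E3) ε).indicator (fun y => ‖u y‖ₑ) (tubeMap D u α x) := by
  classical
  have hΩ := isOpen_punctured hD
  have hx0 : ∀ x ∈ flowTube D u α, x ≠ 0 := fun x hx => norm_pos_iff.1 (hα.trans hx.1)
  have hder : ∀ x ∈ flowTube D u α, ∃ L : E3 →L[ℝ] E3, HasFDerivAt (tubeMap D u α) L x ∧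
      L.det = (α / ‖x‖) ^ 2 * inner ℝ (u ((α / ‖x‖) • x)) (nHat x) := fun x hx => by
    obtain ⟨-, -, c, hc, -⟩ := id hx
    exact exists_hasFDerivAt_tubeMap hD hu hdiv hα (hx0 x hx) hc
  have hproj : MapsTo (fun x : E3 => (α / ‖x‖) • x) (flowTube D u α) (D \ {0}) :=
    fun x ⟨_, _, c, hc, _⟩ => by
      have := hc.2.1 0 (by simp)
      rwa [hc.1] at this
  have hmaps : MapsTo (tubeMap D u α) (flowTube D u α) (D \ {0}) := fun x ⟨_, _, c, hc, _⟩ => by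
    rw [tubeMap_eq hD hu hc]
    exact hc.2.1 1 (by simp)
  choose! L hL hLdet using hder
  have hcont : ContinuousOn (tubeMap D u α) (flowTube D u α) :=
    fun x hx => (hL x hx).continuousAt.continuousWithinAt
  -- On this open set the integrand is continuous, which makes its extension by zero measurable.
  set S := flowTube D u α ∩ tubeMap D u α ⁻¹' ball 0 ε with hS
  have hSo : IsOpen S := hcont.isOpen_inter_preimage (isOpen_flowTube hD hu hα) isOpen_ball
  have hST : S ⊆ flowTube D u α := inter_subset_left
  set f : E3 → ENNReal := fun x => ENNReal.ofReal
    ((α / ‖x‖) ^ 2 * |inner ℝ (u ((α / ‖x‖) • x)) (nHat x)|) * ‖u (tubeMap D u α x)‖ₑ with hf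
  have hninv : ContinuousOn (fun x : E3 => ‖x‖⁻¹) S :=
    continuous_norm.continuousOn.inv₀ fun x hx => norm_ne_zero_iff.2 (hx0 x (hST hx))
  have hdivc : ContinuousOn (fun x : E3 => α / ‖x‖) S := by
    simpa only [div_eq_mul_inv] using! continuousOn_const.mul hninv
  have hfc : ContinuousOn f S := by
    have h1 : ContinuousOn (fun x : E3 => u ((α / ‖x‖) • x)) S :=
      hu.continuousOn.comp (hdivc.smul continuousOn_id) (hproj.mono_left hST)
    have h2 : ContinuousOn (fun x : E3 => nHat x) S := hninv.smul continuousOn_id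
    have h3 : ContinuousOn (fun x => u (tubeMap D u α x)) S :=
      hu.continuousOn.comp (hcont.mono hST) (hmaps.mono_left hST)
    have h5 : ContinuousOn (fun x : E3 =>
        (((α / ‖x‖) ^ 2 * |inner ℝ (u ((α / ‖x‖) • x)) (nHat x)|).toNNReal)) S :=
      continuous_real_toNNReal.comp_continuousOn ((hdivc.pow 2).mul (h1.inner h2).abs)
    have h6 : ContinuousOn (fun x => ((((α / ‖x‖) ^ 2 *
        |inner ℝ (u ((α / ‖x‖) • x)) (nHat x)|).toNNReal * ‖u (tubeMap D u α x)‖₊ : NNReal) :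
          ENNReal)) S :=
      ENNReal.continuous_coe.comp_continuousOn (h5.mul h3.nnnorm)
    refine h6.congr fun x _ => ?_
    simp only [hf, ENNReal.coe_mul]
    rfl
  refine ⟨S.indicator f, ?_, ?_, ?_⟩
  · rw [← piecewise_eq_indicator]
    exact hfc.measurable_piecewise continuousOn_const hSo.measurableSet
  · rw [lintegral_indicator hSo.measurableSet]
    have h1 := lintegral_image_eq_lintegral_abs_det_fderiv_mul volume hSo.measurableSet
      (fun x hx => (hL x (hST hx)).hasFDerivWithinAt) ((injOn_tubeMap hD hu hα).mono hST)
      (fun y => ‖u y‖ₑ)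
    have h2 : ∫⁻ x in S, f x =
        ∫⁻ x in S, ENNReal.ofReal |(L x).det| * ‖u (tubeMap D u α x)‖ₑ :=
      setLIntegral_congr_fun hSo.measurableSet fun x hx => by
        simp only [hf, hLdet x (hST hx), abs_mul, abs_pow, sq_abs]
    rw [h2, ← h1]
    refine lintegral_mono_set ?_
    rintro _ ⟨x, hx, rfl⟩
    exact ⟨(hmaps (hST hx)).1, hx.2⟩
  · intro x hx
    by_cases hxε : tubeMap D u α x ∈ ball (0 : E3) ε
    · rw [indicator_of_mem (show x ∈ S from ⟨hx, hxε⟩), indicator_of_mem hxε]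
    · rw [indicator_of_notMem (s := S) fun h => hxε h.2, indicator_of_notMem hxε, mul_zero]

/-- The flux which reaches a neighbourhood of the origin bounds the integral of the speed over
small balls from below. -/
lemma flux_mul_le_lintegral (hD : IsOpen D) (hu : ContDiffOn ℝ 1 u (D \ {0}))
    (hdiv : ∀ x ∈ D \ {0}, divergence u x = 0) (hα : 0 < α) {A : Set E3}
    (hAm : NullMeasurableSet A (sphereMeasure α)) {r ε : ℝ}
    (hrε : r < ε) (hεα : ε ≤ α) (hstream : A ⊆ streamSet D u r α) :
    ENNReal.ofReal (ε - r) * ∫⁻ x in A, ‖(inner ℝ (u x) (nHat x) : ℝ)‖ₑ ∂(sphereMeasure α) ≤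
      ∫⁻ x in D ∩ ball 0 ε, ‖u x‖ₑ := by
  obtain ⟨g, hgm, hgle, hg⟩ := lintegral_tube_le hD hu hdiv hα ε
  refine le_trans ?_ hgle
  have hemb : MeasurableEmbedding (fun x : sphere (0 : E3) 1 => α • (x : E3)) :=
    ((Homeomorph.smulOfNeZero α hα.ne').measurableEmbedding).comp
      (MeasurableEmbedding.subtype_coe isClosed_sphere.measurableSet)
  rw [← lintegral_indicator₀ hAm, sphereMeasure, lintegral_smul_measure, hemb.lintegral_map,
    lintegral_polar_E3 hgm, smul_eq_mul, ← mul_assoc,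
    ← lintegral_const_mul' _ _ (ENNReal.mul_ne_top ENNReal.ofReal_ne_top ENNReal.ofReal_ne_top)]
  refine lintegral_mono fun ω => ?_
  have hω : ‖(ω : E3)‖ = 1 := by simp
  by_cases hωA : α • (ω : E3) ∈ A
  swap
  · rw [indicator_of_notMem hωA, mul_zero]; exact zero_le
  rw [indicator_of_mem hωA]
  have hnα : ‖α • (ω : E3)‖ = α := by rw [norm_smul, hω, mul_one, Real.norm_of_nonneg hα.le]
  have hnHat : ∀ ρ : ℝ, 0 < ρ → nHat (ρ • (ω : E3)) = ω := fun ρ hρ => by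
    rw [nHat, norm_smul, hω, mul_one, Real.norm_of_nonneg hρ.le, smul_smul,
      inv_mul_cancel₀ hρ.ne', one_smul]
  rw [hnHat α hα]
  obtain ⟨-, s, hs, γ, hγ, hγr, hγb⟩ := hstream hωA
  set q : ℝ := inner ℝ (u (α • (ω : E3))) ω with hq
  -- The tube requires strict inflow. Tangential points carry no flux, and outflow is impossible.
  rcases eq_or_ne q 0 with hq0 | hq0
  · simp [hq0]
  have hqneg : q < 0 := by
    have := inner_nonpos_of_isStreamline hs hγ (by rwa [hnα])
    rw [inner_smul_right] at this
    exact lt_of_le_of_ne (nonpos_of_mul_nonpos_right this hα) hq0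
  have hlen := le_lintegral_speed hu hs hrε (by rwa [hnα]) hγ hγr
  -- The polar weight (t + α)² cancels the denominator of the Jacobian (α/(t + α))² |q|.
  have hpt : ∀ t ∈ Ioo 0 s, ENNReal.ofReal ((t + α) ^ 2) * g ((t + α) • (ω : E3)) =
      ENNReal.ofReal (α ^ 2) * ‖q‖ₑ * (ball (0 : E3) ε).indicator (fun y => ‖u y‖ₑ) (γ t) := by
    intro t ht
    have htα : 0 < t + α := add_pos ht.1 hα
    obtain ⟨h1, h2⟩ := mem_flowTube_of_isStreamline hD hu hα hω hqneg hγ hγb ht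
    have hnt : ‖(t + α) • (ω : E3)‖ = t + α := by
      rw [norm_smul, hω, mul_one, Real.norm_of_nonneg htα.le]
    rw [hg _ h1, h2, hnHat _ htα, hnt, smul_smul, div_mul_cancel₀ _ htα.ne', ← hq, ← mul_assoc,
      ← ENNReal.ofReal_mul (by positivity), ← ofReal_norm q, Real.norm_eq_abs,
      ← ENNReal.ofReal_mul (by positivity)]
    congr 2
    field_simp
  calc ENNReal.ofReal (ε - r) * ENNReal.ofReal (α ^ 2) * ‖q‖ₑ
      = ENNReal.ofReal (α ^ 2) * ‖q‖ₑ * ENNReal.ofReal (ε - r) := by ring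
    _ ≤ ENNReal.ofReal (α ^ 2) * ‖q‖ₑ *
        ∫⁻ t in Ioo 0 s, (ball (0 : E3) ε).indicator (fun y => ‖u y‖ₑ) (γ t) := by gcongr
    _ = ∫⁻ t in Ioo 0 s, ENNReal.ofReal ((t + α) ^ 2) * g ((t + α) • (ω : E3)) := by
        rw [← lintegral_const_mul' _ _ (ENNReal.mul_ne_top ENNReal.ofReal_ne_top enorm_ne_top)]
        exact setLIntegral_congr_fun measurableSet_Ioo fun t ht => (hpt t ht).symm
    -- Time t corresponds to radius t + α, so translation invariance turns the time integral into
    -- the radial one.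
    _ ≤ ∫⁻ t, (Ioi (0 : ℝ)).indicator
          (fun ρ => ENNReal.ofReal (ρ ^ 2) * g (ρ • (ω : E3))) (t + α) := by
        rw [← lintegral_indicator measurableSet_Ioo]
        refine lintegral_mono fun t => ?_
        by_cases ht : t ∈ Ioo 0 s
        · rw [indicator_of_mem ht, indicator_of_mem (show t + α ∈ Ioi 0 from add_pos ht.1 hα)]
        · rw [indicator_of_notMem ht]; exact zero_le
    _ = _ := by
        rw [lintegral_add_right_eq_self (fun ρ => (Ioi (0 : ℝ)).indicator
          (fun ρ => ENNReal.ofReal (ρ ^ 2) * g (ρ • (ω : E3))) ρ) α,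
          lintegral_indicator measurableSet_Ioi]

end Flux

/-! ### The square integrable bound and the conclusion. -/

/-- The integral of a square integrable field over a ball of radius `ε` is `O(ε ^ (3 / 2))`. -/
lemma lintegral_ball_le_of_memLp {D : Set E3} {u : E3 → E3}
    (h : MemLp u 2 (volume.restrict D)) :
    ∃ C : ℝ, 0 ≤ C ∧ ∀ ε > 0,
      ∫⁻ x in D ∩ ball 0 ε, ‖u x‖ₑ ≤ ENNReal.ofReal (C * (ε * √ε)) := by
  set N := eLpNorm u 2 (volume.restrict D) with hN
  have hNt : N ≠ ⊤ := h.2.ne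
  set V := volume (ball (0 : E3) 1) with hV
  have hVt : V ≠ ⊤ := measure_ball_lt_top.ne
  refine ⟨N.toReal * √V.toReal, by positivity, fun ε hε => ?_⟩
  have hle : volume.restrict (D ∩ ball 0 ε) ≤ (volume : Measure E3).restrict D :=
    Measure.restrict_mono inter_subset_left le_rfl
  have h1 := eLpNorm_le_eLpNorm_mul_rpow_measure_univ (μ := volume.restrict (D ∩ ball 0 ε))
    (p := 1) (q := 2) (by norm_num) (h.1.mono_measure hle)
  rw [eLpNorm_one_eq_lintegral_enorm] at h1
  refine h1.trans ?_
  have h2 : (volume.restrict (D ∩ ball (0 : E3) ε)) univ ≤ ENNReal.ofReal (ε ^ 3 * V.toReal) := by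
    rw [Measure.restrict_apply_univ]
    refine (measure_mono inter_subset_right).trans ?_
    rw [Measure.addHaar_ball _ _ hε.le, finrank_euclideanSpace, Fintype.card_fin,
      ENNReal.ofReal_mul (by positivity), ENNReal.ofReal_toReal hVt]
  have h3 : (volume.restrict (D ∩ ball (0 : E3) ε)) univ ^
      (1 / (1 : ENNReal).toReal - 1 / (2 : ENNReal).toReal) ≤ ENNReal.ofReal (ε * √ε * √V.toReal) := by
    have e : (1 / (1 : ENNReal).toReal - 1 / (2 : ENNReal).toReal) = 1 / 2 := by norm_num
    rw [e]
    refine (ENNReal.rpow_le_rpow h2 (by norm_num)).trans (le_of_eq ?_)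
    rw [ENNReal.ofReal_rpow_of_nonneg (by positivity) (by norm_num), ← Real.sqrt_eq_rpow,
      Real.sqrt_mul (by positivity), show ε ^ 3 = ε ^ 2 * ε by ring, Real.sqrt_mul (by positivity),
      Real.sqrt_sq hε.le]
  calc _ ≤ N * ENNReal.ofReal (ε * √ε * √V.toReal) :=
        mul_le_mul' (eLpNorm_mono_measure u hle) h3
    _ = _ := by
        conv_lhs => rw [← ENNReal.ofReal_toReal hNt]
        rw [← ENNReal.ofReal_mul (by positivity)]
        congr 1
        ring

end

theorem corollary1 (D : Set E3) (hD : IsOpen D) (h0 : (0 : E3) ∈ D)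
    (u : E3 → E3) (hu : ContDiffOn ℝ 1 u (D \ {0}))
    (hdiv : ∀ x ∈ D \ {0}, divergence u x = 0)
    (α : ℝ) (hα : 0 < α)
    (A : Set E3) (hA : A ⊆ sphere (0 : E3) α) (hAm : NullMeasurableSet A (sphereMeasure α))
    (hflux : ∫ x in A, inner ℝ (u x) (nHat x) ∂(sphereMeasure α) ≠ 0)
    (hstream : ∀ r : ℝ, 0 < r → r < α → A ⊆ streamSet D u r α) :
    ¬ MemLp u 2 (volume.restrict D) := by
  intro hL2
  obtain ⟨C, hC0, hC⟩ := lintegral_ball_le_of_memLp hL2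
  set f : ℝ := ‖∫ x in A, inner ℝ (u x) (nHat x) ∂(sphereMeasure α)‖ with hf
  have hf0 : 0 < f := norm_pos_iff.2 hflux
  have hfle : ENNReal.ofReal f ≤
      ∫⁻ x in A, ‖(inner ℝ (u x) (nHat x) : ℝ)‖ₑ ∂(sphereMeasure α) := by
    rw [hf, ofReal_norm]
    exact enorm_integral_le_lintegral_enorm _
  have key : ∀ ε, 0 < ε → ε ≤ α → f ≤ 2 * C * √ε := fun ε hε hεα => by
    have h1 := flux_mul_le_lintegral (r := ε / 2) hD hu hdiv hα hAm (by linarith) hεα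
      (hstream (ε / 2) (by linarith) (by linarith))
    have h2 : ENNReal.ofReal ((ε - ε / 2) * f) ≤ ENNReal.ofReal (C * (ε * √ε)) := by
      rw [ENNReal.ofReal_mul (by linarith)]
      exact (mul_le_mul_right hfle _).trans (h1.trans (hC ε hε))
    rw [ENNReal.ofReal_le_ofReal_iff (by positivity)] at h2
    have h3 : ε * f ≤ ε * (2 * C * √ε) := by linarith
    exact le_of_mul_le_mul_left h3 hε
  -- With √ε ≤ b the bound 2 C √ε is below f/2, which contradicts `key`.
  set b : ℝ := f / (4 * (C + 1)) with hb
  have hb0 : 0 < b := by positivity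
  have h1 := key (min α (b ^ 2)) (by positivity) (min_le_left _ _)
  have h2 : √(min α (b ^ 2)) ≤ b := by
    rw [Real.sqrt_le_left hb0.le]
    exact min_le_right _ _
  have h3 : b * (4 * (C + 1)) = f := by rw [hb]; field_simp
  nlinarith [mul_le_mul_of_nonneg_left h2 hC0]
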